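/- Let $A$ be a unital complex Banach algebra (with $\|ab\|\le\|a\|\|b\|$) and let $R$ be its Jacobson radical. A unital left Banach $A$-module is a complex Banach space $X$ with a compatible unital left $A$-module structure satisfying $\|a\cdot x\|\le\|a\|\,\|x\|$; morphisms are bounded $A$-linear maps. We use the following notions, all modules being unital left Banach $A$-modules. (i) A morphism $\psi\colon X_0\to X$ is *small* if every morphism $\varphi\colon Y\to X$ for which $Y\oplus X_0\to X$, $(y,z)\mapsto\varphi(y)+\psi(z)$, is surjective is itself surjective. (ii) A contractive (i.e. of norm $\le 1$) monomorphism $\alpha\colon Y\to X$ is *maximal* if it is not surjective and, whenever $\alpha=\beta\kappa$ with $\beta$ a non-surjective contractive monomorphism and $\kappa$ a contractive morphism, $\kappa$ is an isometric isomorphism. (iii) The *topological radical* $\operatorname{trad}X$ is described from inside as the union of the ranges of all small morphisms into $X$, and from outside as the intersection of the ranges of all maximal contractive monomorphisms into $X$ (the whole of $X$ if there are none). (iv) $P$ is *projective* if every morphism $\varepsilon\colon Y\to P$ that has a right inverse bounded linear operator has a right inverse morphism. (v) A Banach space $E$ has the *approximation property* if for every compact $K\subset E$ and every $\delta>0$ there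 is a bounded finite-rank operator $T$ on $E$ with $\|Tx-x\|<\delta$ for all $x\in K$. Proposition. Let $P$ be a projective unital left Banach $A$-module whose underlying Banach space has the approximation property. Then $\operatorname{trad}P=\overline{R\cdot P}$, where $R\cdot P$ is the submodule consisting of all finite sums $\sum_i r_i\cdot x_i$ with $r_i\in R$, $x_i\in P$. Explicitly, both the union of the ranges of all small morphisms into $P$ and the intersection of the ranges of all maximal contractive monomorphisms into $P$ are equal to $\overline{R\cdot P}$. -/

import Mathlib

universe u v w

/-!  In this file a unital left Banach module over a complex Banach algebra `A` is a type `X` with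
`[NormedAddCommGroup X] [NormedSpace ℂ X] [CompleteSpace X] [Module A X] [IsScalarTower ℂ A X]
[IsBoundedSMul A X]`; the last condition says that `‖a • x‖ ≤ ‖a‖ * ‖x‖`. Morphisms are the
continuous `A`-linear maps `X →L[A] Y`. -/

namespace BanachModule

section Morphisms

variable {A : Type u} [NormedRing A] [NormedAlgebra ℂ A]
variable {X : Type v} [NormedAddCommGroup X] [NormedSpace ℂ X] [Module A X]

/-- A morphism `ψ : X₀ → X` of Banach modules is small if every morphism `φ : Y → X` of Banach
modules for which `(y, z) ↦ φ y + ψ z` is surjective is itself surjective. -/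
def IsSmall {X₀ : Type w} [NormedAddCommGroup X₀] [NormedSpace ℂ X₀] [Module A X₀]
    (ψ : X₀ →L[A] X) : Prop :=
  ∀ (Y : Type (max u v)) [NormedAddCommGroup Y] [NormedSpace ℂ Y] [CompleteSpace Y]
    [Module A Y] [IsScalarTower ℂ A Y] [IsBoundedSMul A Y] (φ : Y →L[A] X),
    Function.Surjective (fun p : Y × X₀ => φ p.1 + ψ p.2) → Function.Surjective φ

/-- A morphism of norm at most `1`. -/
def IsContractive {Y : Type w} [NormedAddCommGroup Y] [Module A Y] (f : Y →L[A] X) : Prop :=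
  ∀ y : Y, ‖f y‖ ≤ ‖y‖

/-- A maximal contractive monomorphism `α : Y → X`: a non-surjective contractive monomorphism such
that, whenever `α = β ∘ κ` with `β` a non-surjective contractive monomorphism and `κ` a contractive
morphism, `κ` is an isometric isomorphism. -/
def IsMaximalContractiveMono {Y : Type w} [NormedAddCommGroup Y] [NormedSpace ℂ Y] [Module A Y]
    (α : Y →L[A] X) : Prop :=
  (IsContractive α ∧ Function.Injective α ∧ ¬ Function.Surjective α) ∧
  ∀ (Z : Type (max u v)) [NormedAddCommGroup Z] [NormedSpace ℂ Z] [CompleteSpace Z]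
    [Module A Z] [IsScalarTower ℂ A Z] [IsBoundedSMul A Z] (β : Z →L[A] X) (κ : Y →L[A] Z),
    IsContractive β → Function.Injective β → ¬ Function.Surjective β → IsContractive κ →
    α = β.comp κ → Isometry κ ∧ Function.Surjective κ

end Morphisms

section Radical

variable (A : Type u) [NormedRing A] [NormedAlgebra ℂ A]
variable (X : Type v) [NormedAddCommGroup X] [NormedSpace ℂ X] [Module A X]

/-- The union of the ranges of all small morphisms into `X`: the topological radical of `X`,
described from inside. -/
def tradInner : Set X :=
  {x | ∃ (X₀ : Type (max u v)) (_ : NormedAddCommGroup X₀) (_ : NormedSpace ℂ X₀)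
    (_ : CompleteSpace X₀) (_ : Module A X₀) (_ : IsScalarTower ℂ A X₀) (_ : IsBoundedSMul A X₀)
    (ψ : X₀ →L[A] X), IsSmall ψ ∧ x ∈ Set.range ψ}

/-- The intersection of the ranges of all maximal contractive monomorphisms into `X`: the
topological radical of `X`, described from outside. -/
def tradOuter : Set X :=
  {x | ∀ (Y : Type (max u v)) [NormedAddCommGroup Y] [NormedSpace ℂ Y] [CompleteSpace Y]
    [Module A Y] [IsScalarTower ℂ A Y] [IsBoundedSMul A Y] (γ : Y →L[A] X),
    IsMaximalContractiveMono γ → x ∈ Set.range γ}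

/-- A Banach module `P` is projective if every morphism of Banach modules into `P` that has a
right inverse bounded linear operator has a right inverse morphism. -/
def IsProjective : Prop :=
  ∀ (Y : Type (max u v)) [NormedAddCommGroup Y] [NormedSpace ℂ Y] [CompleteSpace Y]
    [Module A Y] [IsScalarTower ℂ A Y] [IsBoundedSMul A Y] (ε : Y →L[A] X),
    (∃ σ : X →L[ℂ] Y, ∀ x, ε (σ x) = x) → ∃ ρ : X →L[A] Y, ∀ x, ε (ρ x) = x

end Radical

/-- The approximation property of a Banach space: the identity is a limit of bounded operators of
finite rank, uniformly on compact sets. -/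
def HasApproximationProperty (E : Type v) [NormedAddCommGroup E] [NormedSpace ℂ E] : Prop :=
  ∀ K : Set E, IsCompact K → ∀ δ : ℝ, 0 < δ →
    ∃ T : E →L[ℂ] E, FiniteDimensional ℂ (LinearMap.range (T : E →ₗ[ℂ] E)) ∧
      ∀ x ∈ K, ‖T x - x‖ < δ

end BanachModule

open Set Filter Topology

namespace BanachModule

section NormedModule

variable {A : Type u} [NormedRing A] {X : Type v} [NormedAddCommGroup X] [Module A X]

/-! The chain `closure (R·P) ⊆ tradInner ⊆ tradOuter ⊆ closure (R·P)` is proved; only the last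
inclusion uses projectivity and the approximation property. For `x` in the closure, `a ↦ a • x` is
small: otherwise a maximal submodule, closed by the open mapping theorem, omits `x`, yet it contains
`R·X` (`isSmall_toSpanSingleton_of_mem_closure`). A maximal monomorphism absorbs each small morphism
`ψ`, since it factors through the image of its sum with `ψ`
(`IsMaximalContractiveMono.range_subset`). For the last inclusion, morphisms `P → A` send
`tradOuter` into `R`. Projectivity splits `A ⊗ P → P` by some `ρ`, and slicing `ρ x` by functionals
gives such morphisms. Applying `1 ⊗ T` with `T` of finite rank to `ρ x` and multiplying therefore
lands in `R·P`, and the approximation property brings the result close to `x`. -/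

theorem isBoundedSMul_quotient [IsBoundedSMul A X] (S : Submodule A X) :
    IsBoundedSMul A (X ⧸ S) := by
  refine .of_norm_smul_le fun a x => ?_
  have key : ∀ n : ℕ, ‖a • x‖ ≤ ‖a‖ * (‖x‖ + 1 / ((n : ℝ) + 1)) := by
    intro n
    obtain ⟨m, rfl, hm⟩ := Submodule.Quotient.norm_mk_lt x (Nat.one_div_pos_of_nat (n := n))
    calc ‖a • (Submodule.Quotient.mk m : X ⧸ S)‖ ≤ ‖a • m‖ :=
          Submodule.Quotient.norm_mk_le S (a • m)
      _ ≤ ‖a‖ * ‖m‖ := norm_smul_le a m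
      _ ≤ _ := by gcongr
  refine ge_of_tendsto' (f := fun n : ℕ => ‖a‖ * (‖x‖ + 1 / ((n : ℝ) + 1))) (x := atTop) ?_ key
  simpa using (tendsto_one_div_add_atTop_nhds_zero_nat (𝕜 := ℝ)).const_add ‖x‖ |>.const_mul ‖a‖

/-- The radicals quantify over modules in the universe `max u v`, so submodules of `X` and `A`
itself enter through `ULift`. -/
theorem isBoundedSMul_ulift [IsBoundedSMul A X] : IsBoundedSMul A (ULift.{w} X) :=
  .of_norm_smul_le fun a x => norm_smul_le a x.down

theorem completeSpace_ulift (X : Type v) [NormedAddCommGroup X] [CompleteSpace X] :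
    CompleteSpace (ULift.{w} X) :=
  (completeSpace_congr (e := (Equiv.ulift : ULift.{w} X ≃ X))
    ⟨⟨rfl⟩, Equiv.ulift.injective⟩).2 inferInstance

/-- The projection of a universe lift as a morphism. -/
def uliftDown (A : Type u) [NormedRing A] (X : Type v) [NormedAddCommGroup X] [Module A X] :
    ULift.{w} X →L[A] X :=
  (ContinuousLinearEquiv.ulift : ULift.{w} X ≃L[A] X).toContinuousLinearMap

end NormedModule

/-! ### The inclusions valid for every Banach module, and morphisms into `A`. -/

section Radical

variable {A : Type u} [NormedRing A] [NormedAlgebra ℂ A]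
variable {X : Type v} [NormedAddCommGroup X] [NormedSpace ℂ X] [Module A X]

/-- The range of a maximal contractive monomorphism contains the range of each small morphism. -/
theorem IsMaximalContractiveMono.range_subset {Y X₀ : Type (max u v)} [NormedAddCommGroup Y]
    [NormedSpace ℂ Y] [CompleteSpace Y] [Module A Y] [IsScalarTower ℂ A Y] [IsBoundedSMul A Y]
    [NormedAddCommGroup X₀] [NormedSpace ℂ X₀] [CompleteSpace X₀] [Module A X₀]
    [IsScalarTower ℂ A X₀] [IsBoundedSMul A X₀] [IsScalarTower ℂ A X] {α : Y →L[A] X}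
    (hα : IsMaximalContractiveMono α) {ψ : X₀ →L[A] X} (hψ : IsSmall ψ) :
    range ψ ⊆ range α := by
  obtain ⟨⟨hc, -, hs⟩, hmax⟩ := hα
  have hns : ¬ Function.Surjective fun p : Y × X₀ => α p.1 + ψ p.2 := fun h => hs (hψ Y α h)
  obtain ⟨C, hC, hψC⟩ : ∃ C : ℝ, 0 < C ∧ ∀ z, ‖ψ z‖ ≤ C * ‖z‖ := 
    (ψ.restrictScalars ℂ).bound
  have hC' : (C : ℂ) ≠ 0 := by exact_mod_cast hC.ne'
  -- Dividing `ψ` by its bound `C` makes the map contractive for the `ℓ¹` norm without changing its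
  -- range; its image, with the quotient norm, tests the maximality of `α`.
  let f : WithLp 1 (Y × X₀) →ₗ[A] X :=
    { toFun := fun p => α p.fst + (C : ℂ)⁻¹ • ψ p.snd
      map_add' := fun p q => by simp [smul_add]; abel
      map_smul' := fun a p => by
        have : (C : ℂ)⁻¹ • a • ψ p.snd = a • (C : ℂ)⁻¹ • ψ p.snd := by
          have : SMulCommClass ℂ A X := IsScalarTower.to_smulCommClass
          exact smul_comm _ _ _
        simp [smul_add, this] }
  have hf : ∀ p, ‖f p‖ ≤ ‖p‖ := by
    intro p
    rw [WithLp.prod_norm_eq_of_L1]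
    refine (norm_add_le _ _).trans (add_le_add (hc _) ?_)
    rw [norm_smul, norm_inv, Complex.norm_real, Real.norm_of_nonneg hC.le,
      inv_mul_le_iff₀ hC]
    exact hψC _
  let F : WithLp 1 (Y × X₀) →L[A] X := f.mkContinuous 1 (by simpa using hf)
  have hcl : IsClosed (F.ker : Set (WithLp 1 (Y × X₀))) := F.isClosed_ker
  have := isBoundedSMul_quotient F.ker
  have hF : ∀ (y : Y) (z : X₀), F (WithLp.toLp 1 (y, z)) = α y + (C : ℂ)⁻¹ • ψ z := fun _ _ => rfl
  let i : Y →ₗ[A] WithLp 1 (Y × X₀) :=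
    { toFun := fun y => WithLp.toLp 1 (y, 0)
      map_add' := fun y z => by rw [← WithLp.toLp_add]; simp
      map_smul' := fun a y => by rw [RingHom.id_apply, ← WithLp.toLp_smul]; simp }
  have hi' : ∀ y, ‖i y‖ ≤ ‖y‖ := fun y => by simp [i]
  let κ : Y →L[A] (WithLp 1 (Y × X₀) ⧸ F.ker) :=
    F.ker.mkQL.comp (i.mkContinuous 1 (by simpa using hi'))
  let β : (WithLp 1 (Y × X₀) ⧸ F.ker) →L[A] X := F.ker.liftQL F le_rfl
  have hβ : ∀ p, β (Submodule.Quotient.mk p) = F p := fun p => rfl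
  have hβκ : ∀ y, α y = β (κ y) := fun y => by
    change α y = F (WithLp.toLp 1 (y, 0))
    simp [hF]
  have hβs : ∀ y z, (α y + ψ z) ∈ range β := fun y z =>
    ⟨Submodule.Quotient.mk (WithLp.toLp 1 (y, (C : ℂ) • z)), by
      rw [hβ, hF]
      have : ψ ((C : ℂ) • z) = (C : ℂ) • ψ z := (ψ.restrictScalars ℂ).map_smul _ _
      rw [this, inv_smul_smul₀ hC']⟩
  have hβn : ¬ Function.Surjective β := by
    intro hsur
    refine hns fun x => ?_
    obtain ⟨q, rfl⟩ := hsur x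
    obtain ⟨p, rfl⟩ := Submodule.Quotient.mk_surjective _ q
    refine ⟨(p.fst, (C : ℂ)⁻¹ • p.snd), ?_⟩
    have : ψ ((C : ℂ)⁻¹ • p.snd) = (C : ℂ)⁻¹ • ψ p.snd := (ψ.restrictScalars ℂ).map_smul _ _
    exact congrArg (α p.fst + ·) this
  have hβc : IsContractive β := by
    intro q
    refine le_of_forall_pos_le_add fun ε hε => ?_
    obtain ⟨p, rfl, hp⟩ := Submodule.Quotient.norm_mk_lt q hε
    exact (hf p).trans hp.le
  have hβi : Function.Injective β := by
    rw [injective_iff_map_eq_zero]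
    intro q hq
    obtain ⟨p, rfl⟩ := Submodule.Quotient.mk_surjective _ q
    exact (Submodule.Quotient.mk_eq_zero _).2 hq
  have hκc : IsContractive κ := fun y => (Submodule.Quotient.norm_mk_le _ _).trans (hi' y)
  obtain ⟨-, hκs⟩ := hmax _ β κ hβc hβi hβn hκc (ContinuousLinearMap.ext hβκ)
  rintro _ ⟨z, rfl⟩
  obtain ⟨q, hq⟩ := hβs 0 z
  obtain ⟨y, rfl⟩ := hκs q
  exact ⟨y, by rw [hβκ, hq]; simp⟩

theorem tradInner_subset_tradOuter [IsScalarTower ℂ A X] : tradInner A X ⊆ tradOuter A X := by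
  rintro x ⟨X₀, _, _, _, _, _, _, ψ, hψ, hx⟩ Y _ _ _ _ _ _ γ hγ
  exact hγ.range_subset hψ hx

/-- The inclusion of a closed maximal submodule is a maximal contractive monomorphism. -/
theorem tradOuter_subset_of_isCoatom [CompleteSpace X] [IsScalarTower ℂ A X] [IsBoundedSMul A X]
    {M : Submodule A X} (hM : IsCoatom M) (hcl : IsClosed (M : Set X)) : tradOuter A X ⊆ M := by
  intro x hx
  have : CompleteSpace M := hcl.completeSpace_coe
  have : IsBoundedSMul A M := .of_norm_smul_le fun a x => norm_smul_le a (x : X)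
  have := completeSpace_ulift.{v, u} M
  have := isBoundedSMul_ulift.{u, v, u} (A := A) (X := M)
  let ι : ULift.{u} M →L[A] X := M.subtypeL.comp (uliftDown A M)
  have hι : ∀ m, ι m = (m.down : X) := fun _ => rfl
  have hr : range ι = M := by
    ext y
    exact ⟨fun ⟨m, hm⟩ => hm ▸ m.down.2, fun hy => ⟨⟨⟨y, hy⟩⟩, rfl⟩⟩
  rw [← hr]
  refine hx _ ι ⟨⟨fun m => le_rfl, fun m n h => ULift.ext _ _ (Subtype.ext h), fun h => ?_⟩, ?_⟩
  · exact hM.1 (SetLike.coe_injective (hr.symm.trans h.range_eq))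
  · intro Z _ _ _ _ _ _ β κ hβ hβi hβs hκ h
    have hk : ∀ m, ι m = β (κ m) := fun m => by rw [h]; rfl
    refine ⟨AddMonoidHomClass.isometry_of_norm κ fun m => le_antisymm (hκ m) ?_, ?_⟩
    · calc ‖m‖ = ‖ι m‖ := rfl
        _ ≤ ‖κ m‖ := hk m ▸ hβ (κ m)
    -- The range of `β` lies between `M` and a proper submodule, so it equals `M`; injectivity of
    -- `β` then makes `κ` onto.
    · have hle : M ≤ LinearMap.range (β : Z →ₗ[A] X) := fun y hy =>
        ⟨κ ⟨⟨y, hy⟩⟩, (hk _).symm⟩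
      have hM' : LinearMap.range (β : Z →ₗ[A] X) = M :=
        (hM.le_iff.1 hle).resolve_left fun h => hβs (LinearMap.range_eq_top.1 h)
      intro z
      have hz : β z ∈ M := hM' ▸ LinearMap.mem_range_self (β : Z →ₗ[A] X) z
      exact ⟨⟨⟨β z, hz⟩⟩, hβi (hk _).symm⟩

/-- Maximal left ideals of a Banach algebra are closed, so the preimage of one under `f` is a closed
maximal submodule or everything, and contains `x` either way. -/
theorem apply_mem_jacobson_of_mem_tradOuter [CompleteSpace A] [CompleteSpace X]
    [IsScalarTower ℂ A X] [IsBoundedSMul A X] {x : X} (hx : x ∈ tradOuter A X) (f : X →L[A] A) :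
    f x ∈ Ring.jacobson A := by
  rw [Ring.jacobson_eq_sInf_isMaximal, Submodule.mem_sInf]
  intro I hI
  have hI : Ideal.IsMaximal I := hI
  obtain h | h := Submodule.isCoatom_comap_or_eq_top (f : X →ₗ[A] A) hI.out
  · exact tradOuter_subset_of_isCoatom h (Ideal.IsMaximal.isClosed.preimage f.continuous) hx
  · exact (h ▸ Submodule.mem_top : x ∈ Submodule.comap (f : X →ₗ[A] A) I)

theorem isSmall_toSpanSingleton_of_mem_closure [CompleteSpace A] [CompleteSpace X]
    [IsScalarTower ℂ A X] [IsBoundedSMul A X] {x : X}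
    (hx : x ∈ closure ((Ring.jacobson A • (⊤ : Submodule A X) : Submodule A X) : Set X)) :
    IsSmall (ContinuousLinearMap.toSpanSingleton A x) := by
  intro Y _ _ _ _ _ _ φ hφ
  by_contra hns
  set N : Submodule A X := LinearMap.range (φ : Y →ₗ[A] X) with hN
  -- Modulo the range of `φ`, the module is generated by `x`; a nonzero finitely generated module
  -- has a maximal submodule.
  have hsur : Function.Surjective (N.mkQ ∘ₗ LinearMap.toSpanSingleton A X x) := by
    intro q
    obtain ⟨p, rfl⟩ := N.mkQ_surjective q
    obtain ⟨⟨y, a⟩, rfl⟩ := hφ p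
    refine ⟨a, (Submodule.Quotient.eq N).2 ?_⟩
    refine ⟨-y, ?_⟩
    simp
  have : Module.Finite A (X ⧸ N) := Module.Finite.of_surjective _ hsur
  obtain h | ⟨M', hM', -⟩ := eq_top_or_exists_le_coatom (⊥ : Submodule A (X ⧸ N))
  · apply hns
    apply (LinearMap.range_eq_top (f := (φ : Y →ₗ[A] X))).1
    rw [← Submodule.Quotient.subsingleton_iff]
    exact (Submodule.subsingleton_iff A).1 (subsingleton_of_bot_eq_top h)
  set M := M'.comap N.mkQ with hMdef
  have hM : IsCoatom M := (Submodule.isCoatom_comap_iff N.mkQ_surjective).2 hM'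
  have hNM : ∀ y, φ y ∈ M := fun y => by
    have : N.mkQ (φ y) = 0 := (Submodule.Quotient.mk_eq_zero N).2 ⟨y, rfl⟩
    simp [hMdef, Submodule.mem_comap, this]
  let S : Y × A →L[A] X := φ.coprod (ContinuousLinearMap.toSpanSingleton A x)
  have hS : Function.Surjective S := hφ
  have hq : IsQuotientMap S :=
    ((S.restrictScalars ℂ).isOpenMap hS).isQuotientMap S.continuous hS
  have hI : IsClosed {a : A | a • x ∈ M} := by
    obtain h | h := Submodule.isCoatom_comap_or_eq_top (LinearMap.toSpanSingleton A X x) hM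
    · have : Ideal.IsMaximal (M.comap (LinearMap.toSpanSingleton A X x)) := ⟨h⟩
      exact Ideal.IsMaximal.isClosed (I := M.comap (LinearMap.toSpanSingleton A X x))
    · convert isClosed_univ
      ext a
      have : a ∈ M.comap (LinearMap.toSpanSingleton A X x) := h ▸ Submodule.mem_top
      simpa using this
  -- Since `M` contains the range of `φ`, its preimage under the quotient map `S` is `Y × {a | a • x
  -- ∈ M}`.
  have hcl : IsClosed (M : Set X) := by
    rw [← hq.isClosed_preimage]
    convert hI.preimage continuous_snd (X := Y × A)
    ext p
    simpa [S] using M.add_mem_iff_right (hNM p.1)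
  have hxM : x ∈ M := closure_minimal
    ((Ring.jacobson_smul_top_le A X).trans (sInf_le hM)) hcl hx
  refine hM.1 (eq_top_iff.2 fun y _ => ?_)
  obtain ⟨⟨z, a⟩, rfl⟩ := hφ y
  exact M.add_mem (hNM z) (M.smul_mem a hxM)

theorem closure_jacobson_smul_subset_tradInner [CompleteSpace A] [CompleteSpace X]
    [IsScalarTower ℂ A X] [IsBoundedSMul A X] :
    closure ((Ring.jacobson A • (⊤ : Submodule A X) : Submodule A X) : Set X) ⊆
      tradInner A X := by
  intro x hx
  have := completeSpace_ulift.{u, v} A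
  have := isBoundedSMul_ulift.{u, u, v} (A := A) (X := A)
  refine ⟨ULift.{v} A, inferInstance, inferInstance, inferInstance, inferInstance,
    inferInstance, inferInstance,
    (ContinuousLinearMap.toSpanSingleton A x).comp (uliftDown A A), ?_, ⟨⟨1⟩, ?_⟩⟩
  · intro Y _ _ _ _ _ _ φ hφ
    refine isSmall_toSpanSingleton_of_mem_closure hx Y φ fun z => ?_
    obtain ⟨⟨y, a⟩, h⟩ := hφ z
    exact ⟨(y, a.down), h⟩
  · exact one_smul A x

end Radical

/-! ### Weights tending to zero for a convergent series. -/

/-- A telescoping sum with terms added in increasing order: a new largest term contributes at most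
`2 * (√(b m + B) - √B)`, which amounts to `(√(b m + B) - √B) ^ 2 ≥ 0`. Ties only enlarge the earlier
denominators. -/
theorem sum_div_sqrt_sum_le {ι : Type*} {b : ι → ℝ} (hb : ∀ i, 0 ≤ b i) (F : Finset ι) :
    ∑ i ∈ F, b i / √(∑ j ∈ F with b j ≤ b i, b j) ≤ 2 * √(∑ i ∈ F, b i) := by
  classical
  induction F using Finset.induction_on_max_value b with
  | empty => simp
  | insert m F hm hmax ih =>
    set B := ∑ i ∈ F, b i
    have hB : 0 ≤ B := Finset.sum_nonneg fun i _ => hb i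
    have hfil : (insert m F).filter (fun j => b j ≤ b m) = insert m F :=
      Finset.filter_true_of_mem fun j hj => by
        obtain rfl | hj := Finset.mem_insert.1 hj
        · exact le_rfl
        · exact hmax j hj
    rw [Finset.sum_insert hm, hfil, Finset.sum_insert hm]
    have h1 : ∑ i ∈ F, b i / √(∑ j ∈ insert m F with b j ≤ b i, b j) ≤
        ∑ i ∈ F, b i / √(∑ j ∈ F with b j ≤ b i, b j) := by
      refine Finset.sum_le_sum fun i hi => ?_
      rcases (hb i).eq_or_lt with h0 | h0
      · simp [← h0]
      refine div_le_div_of_nonneg_left (hb i) ?_ (Real.sqrt_le_sqrt ?_)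
      · refine Real.sqrt_pos.2 (h0.trans_le ?_)
        exact Finset.single_le_sum (f := b) (fun j _ => hb j) (by simpa using hi)
      · exact Finset.sum_le_sum_of_subset_of_nonneg
          (Finset.filter_subset_filter _ (Finset.subset_insert _ _)) fun j _ _ => hb j
    have h2 : b m / √(b m + B) ≤ 2 * (√(b m + B) - √B) := by
      rcases (hb m).eq_or_lt with h0 | h0
      · simp [← h0]
      have hp : 0 < √(b m + B) := Real.sqrt_pos.2 (by linarith)
      rw [div_le_iff₀ hp]
      have e1 := Real.sq_sqrt (show 0 ≤ b m + B by linarith)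
      have e2 := Real.sq_sqrt hB
      nlinarith [sq_nonneg (√(b m + B) - √B)]
    linarith

/-- The terms of a convergent series with non-negative terms may be divided by weights tending to
zero without destroying convergence. -/
theorem exists_weight_tendsto_zero {ι : Type*} {b : ι → ℝ} (hb : ∀ i, 0 ≤ b i)
    (hs : Summable b) : ∃ w : ι → ℝ, (∀ i, 0 ≤ w i) ∧ (∀ i, b i ≠ 0 → 0 < w i) ∧
      Tendsto w cofinite (𝓝 0) ∧ Summable fun i => b i / w i := by
  classical
  -- The tail of the series sorted by size, defined without enumerating `ι`; the weight is its
  -- square root.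
  set t : ι → ℝ := fun i => ∑' j, if b j ≤ b i then b j else 0
  have hle : ∀ i j, (if b j ≤ b i then b j else 0) ≤ b j := fun i j => by
    split_ifs <;> simp [hb]
  have hnn : ∀ i j, 0 ≤ (if b j ≤ b i then b j else 0) := fun i j => by
    split_ifs <;> simp [hb]
  have hsum : ∀ i, Summable fun j => if b j ≤ b i then b j else 0 := fun i =>
    Summable.of_nonneg_of_le (hnn i) (hle i) hs
  have ht : ∀ i (F : Finset ι), ∑ j ∈ F with b j ≤ b i, b j ≤ t i := fun i F => by
    rw [Finset.sum_filter]
    exact (hsum i).sum_le_tsum F fun j _ => hnn i j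
  refine ⟨fun i => √(t i), fun i => Real.sqrt_nonneg _, fun i hi => ?_, ?_, ?_⟩
  · refine Real.sqrt_pos.2 (((hb i).lt_of_ne' hi).trans_le ?_)
    simpa [Finset.filter_singleton] using ht i {i}
  -- Dominated convergence: a positive `b j` drops out of `t i` as soon as `b i < b j`, that is, for
  -- all but finitely many `i`.
  · have hlim : Tendsto t cofinite (𝓝 (∑' _ : ι, (0 : ℝ))) := by
      refine tendsto_tsum_of_dominated_convergence hs (fun j => ?_)
        (Eventually.of_forall fun i j => by
          rw [Real.norm_of_nonneg (hnn i j)]; exact hle i j)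
      rcases (hb j).eq_or_lt with h0 | h0
      · simpa [← h0] using tendsto_const_nhds
      · refine tendsto_const_nhds.congr' ?_
        filter_upwards [hs.tendsto_cofinite_zero.eventually_lt_const h0] with i hi
        rw [if_neg hi.not_ge]
    simpa [Function.comp_def] using (Real.continuous_sqrt.tendsto _).comp hlim
  · refine summable_of_sum_le (c := 2 * √(∑' i, b i))
      (fun i => div_nonneg (hb i) (Real.sqrt_nonneg _)) fun F => ?_
    calc ∑ i ∈ F, b i / √(t i) ≤ ∑ i ∈ F, b i / √(∑ j ∈ F with b j ≤ b i, b j) := by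
          refine Finset.sum_le_sum fun i hi => ?_
          rcases (hb i).eq_or_lt with h0 | h0
          · simp [← h0]
          refine div_le_div_of_nonneg_left (hb i) ?_ (Real.sqrt_le_sqrt (ht i F))
          refine Real.sqrt_pos.2 (h0.trans_le ?_)
          exact Finset.single_le_sum (f := b) (fun j _ => hb j) (by simpa using hi)
      _ ≤ 2 * √(∑ i ∈ F, b i) := sum_div_sqrt_sum_le hb F
      _ ≤ _ := by
          gcongr
          exact hs.sum_le_tsum F fun j _ => hb j

/-! ### A model of `A ⊗ P`, its splitting, and finite-rank approximation. -/

section FreeModule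

open Metric

variable {A : Type u} [NormedRing A] [NormedAlgebra ℂ A]
variable {E : Type v} [NormedAddCommGroup E] [NormedSpace ℂ E]
variable {X : Type w} [NormedAddCommGroup X] [NormedSpace ℂ X] [CompleteSpace X] [Module A X]
  [IsBoundedSMul A X]

/-- The space of absolutely summable families in `A` indexed by the unit ball of `E`. -/
abbrev BallL1 (A : Type u) [NormedRing A] (E : Type v) [NormedAddCommGroup E] : Type (max u v) :=
  lp (fun _ : closedBall (0 : E) 1 => A) 1

omit [NormedAlgebra ℂ A] [NormedSpace ℂ E] in
theorem BallL1.hasSum_norm (a : BallL1 A E) : HasSum (fun s => ‖a s‖) ‖a‖ := by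
  simpa using lp.hasSum_norm (p := 1) (by simp) a

omit [NormedAlgebra ℂ A] [CompleteSpace X] in
theorem BallL1.norm_smul_apply_le (u : E →L[ℂ] X) (a : BallL1 A E)
    (s : closedBall (0 : E) 1) :
    ‖a s • u s‖ ≤ ‖u‖ * ‖a s‖ := by
  have hs : ‖(s : E)‖ ≤ 1 := mem_closedBall_zero_iff.1 s.2
  calc ‖a s • u s‖ ≤ ‖a s‖ * ‖u s‖ := norm_smul_le _ _
    _ ≤ ‖a s‖ * (‖u‖ * 1) := by gcongr; exact u.le_opNorm_of_le hs
    _ = _ := by ring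

omit [NormedAlgebra ℂ A] in
theorem BallL1.summable (u : E →L[ℂ] X) (a : BallL1 A E) : Summable fun s => a s • u s :=
  .of_norm_bounded (a.hasSum_norm.summable.mul_left ‖u‖) (norm_smul_apply_le u a)

/-- The morphism `a ↦ ∑ a s • u s` determined by a bounded operator `u`. -/
noncomputable def BallL1.lift (u : E →L[ℂ] X) : BallL1 A E →L[A] X :=
  LinearMap.mkContinuous
    { toFun := fun a => ∑' s, a s • u s
      map_add' := fun a b => by
        rw [← (BallL1.summable u a).tsum_add (BallL1.summable u b)]
        simp [add_smul]
      map_smul' := fun c a => by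
        rw [RingHom.id_apply, ← (BallL1.summable u a).tsum_const_smul]
        simp [mul_smul] }
    ‖u‖ fun a => tsum_of_norm_bounded (a.hasSum_norm.mul_left ‖u‖) (norm_smul_apply_le u a)

omit [NormedAlgebra ℂ A] in
theorem BallL1.hasSum_lift (u : E →L[ℂ] X) (a : BallL1 A E) :
    HasSum (fun s => a s • u s) (lift u a) :=
  (BallL1.summable u a).hasSum

open Classical in
omit [NormedAlgebra ℂ A] in
theorem BallL1.lift_single (u : E →L[ℂ] X) (s : closedBall (0 : E) 1) (c : A) :
    lift u (lp.single 1 s c) = c • u s := by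
  refine (hasSum_lift u _).unique ?_
  convert! hasSum_single s ?_
  · simp
  · intro t ht
    simp [ht]

/-- The element of the unit ball in the direction of `x`. -/
noncomputable def ballDirection (x : E) : closedBall (0 : E) 1 :=
  ⟨(‖x‖ : ℂ)⁻¹ • x, by
    rw [mem_closedBall_zero_iff, norm_smul, norm_inv, Complex.norm_real, norm_norm]
    exact inv_mul_le_one⟩

open Classical in
/-- The element `1 ⊗ x`. -/
noncomputable def BallL1.one_tmul (A : Type u) [NormedRing A] [NormedAlgebra ℂ A] (x : E) : BallL1 A E :=
  lp.single 1 (ballDirection x) (algebraMap ℂ A ‖x‖)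

open Classical in
theorem BallL1.norm_one_tmul_le (x : E) : ‖BallL1.one_tmul A x‖ ≤ ‖(1 : A)‖ * ‖x‖ := by
  rw [BallL1.one_tmul, lp.norm_single one_pos, norm_algebraMap, Complex.norm_real, norm_norm,
    mul_comm]

theorem BallL1.lift_one_tmul [IsScalarTower ℂ A X] (u : E →L[ℂ] X) (x : E) :
    lift u (one_tmul A x) = u x := by
  rw [one_tmul, lift_single, ballDirection, algebraMap_smul, map_smul]
  -- At `x = 0` the direction is `0⁻¹ • 0 = 0`.
  rcases eq_or_ne x 0 with rfl | hx
  · simp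
  · rw [smul_inv_smul₀]
    simpa using hx

/-- Joint kernel of the morphisms that bounded operators from `P` to `P` (only the identity is
needed) and to `A` induce on `BallL1 A P`. The quotient by it plays the role of the projective
tensor product of `A` and `P`. -/
noncomputable def tensorRel (A : Type u) [NormedRing A] [NormedAlgebra ℂ A] [CompleteSpace A]
    (P : Type v) [NormedAddCommGroup P] [NormedSpace ℂ P] [CompleteSpace P] [Module A P]
    [IsBoundedSMul A P] : Submodule A (BallL1 A P) :=
  (BallL1.lift (A := A) (ContinuousLinearMap.id ℂ P)).ker ⊓
    ⨅ u : P →L[ℂ] A, (BallL1.lift (A := A) u).ker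

variable [CompleteSpace A]
variable {P : Type v} [NormedAddCommGroup P] [NormedSpace ℂ P] [CompleteSpace P] [Module A P]
  [IsScalarTower ℂ A P] [IsBoundedSMul A P]

omit [IsScalarTower ℂ A P] in
theorem mem_tensorRel {a : BallL1 A P} : a ∈ tensorRel A P ↔
    BallL1.lift (ContinuousLinearMap.id ℂ P) a = 0 ∧ ∀ u : P →L[ℂ] A, BallL1.lift u a = 0 := by
  simp [tensorRel]

omit [IsScalarTower ℂ A P] in
theorem isClosed_tensorRel : IsClosed (tensorRel A P : Set (BallL1 A P)) := by
  simp only [tensorRel, Submodule.coe_inf, Submodule.coe_iInf]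
  exact (ContinuousLinearMap.isClosed_ker _).inter
    (isClosed_iInter fun u => ContinuousLinearMap.isClosed_ker _)

/-- A projective module has a morphism into the free module that splits the multiplication. -/
theorem IsProjective.exists_lift (hP : IsProjective A P) :
    ∃ ρ : P → BallL1 A P, (∀ x, BallL1.lift (ContinuousLinearMap.id ℂ P) (ρ x) = x) ∧
      ∀ u : P →L[ℂ] A, ∃ f : P →L[A] A, ∀ x, BallL1.lift u (ρ x) = f x := by
  have hcl : IsClosed (tensorRel A P : Set (BallL1 A P)) := isClosed_tensorRel
  have hb := isBoundedSMul_quotient (tensorRel A P)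
  let ε : (BallL1 A P ⧸ tensorRel A P) →L[A] P :=
    (tensorRel A P).liftQL (BallL1.lift (ContinuousLinearMap.id ℂ P))
      fun a ha => (mem_tensorRel.1 ha).1
  let S (u : P →L[ℂ] A) : (BallL1 A P ⧸ tensorRel A P) →L[A] A :=
    (tensorRel A P).liftQL (BallL1.lift u) fun a ha => (mem_tensorRel.1 ha).2 u
  -- `x ↦ 1 ⊗ x` is not linear into `BallL1 A P`, but every lift defining `tensorRel` sends it to
  -- the linear map `u`, so it is linear in the quotient.
  let σ : P →ₗ[ℂ] (BallL1 A P ⧸ tensorRel A P) :=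
    { toFun := fun x => Submodule.Quotient.mk (BallL1.one_tmul A x)
      map_add' := fun x y => by
        rw [← Submodule.Quotient.mk_add, Submodule.Quotient.eq, mem_tensorRel]
        simp [BallL1.lift_one_tmul]
      map_smul' := fun c x => by
        rw [RingHom.id_apply, ← Submodule.Quotient.mk_smul, Submodule.Quotient.eq, mem_tensorRel]
        simp [BallL1.lift_one_tmul] }
  obtain ⟨ρ, hρ⟩ := hP _ ε ⟨σ.mkContinuous ‖(1 : A)‖ fun x =>
    (Submodule.Quotient.norm_mk_le _ _).trans (BallL1.norm_one_tmul_le x), fun x => by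
      exact BallL1.lift_one_tmul (A := A) (ContinuousLinearMap.id ℂ P) x⟩
  -- The representatives need not depend linearly on `x`; only their lifts, which factor through the
  -- quotient, do.
  choose r hr using fun x => Submodule.Quotient.mk_surjective _ (ρ x)
  refine ⟨r, fun x => ?_, fun u => ⟨(S u).comp ρ, fun x => ?_⟩⟩
  · have := hρ x
    rw [← hr x] at this
    exact this
  · rw [ContinuousLinearMap.comp_apply, ← hr x]
    rfl

omit [NormedAlgebra ℂ A] [CompleteSpace A] [IsScalarTower ℂ A P] in
/-- On a fixed summable family, operators of finite rank approximate the multiplication. -/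
theorem HasApproximationProperty.exists_norm_lift_sub_lt (hP : HasApproximationProperty P)
    (a : BallL1 A P) {δ : ℝ} (hδ : 0 < δ) : ∃ T : P →L[ℂ] P,
      FiniteDimensional ℂ (LinearMap.range (T : P →ₗ[ℂ] P)) ∧
      ‖BallL1.lift T a - BallL1.lift (ContinuousLinearMap.id ℂ P) a‖ < δ := by
  obtain ⟨w, hw0, hw, hlim, hsum⟩ := exists_weight_tendsto_zero (fun s => norm_nonneg (a s))
    a.hasSum_norm.summable
  -- The unit ball need not be compact, but its points scaled by `w` form with `0` a compact set.
  -- Undoing the scaling costs `1 / w s`, which `‖a s‖` still absorbs.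
  have hK : Tendsto (fun s : closedBall (0 : P) 1 => (w s : ℂ) • (s : P)) cofinite (𝓝 0) := by
    refine squeeze_zero_norm (fun s => ?_) hlim
    have hs : ‖(s : P)‖ ≤ 1 := mem_closedBall_zero_iff.1 s.2
    rw [norm_smul, Complex.norm_real, Real.norm_of_nonneg (hw0 s)]
    exact mul_le_of_le_one_right (hw0 s) hs
  set D : ℝ := ∑' s, ‖a s‖ / w s
  have hD : 0 ≤ D := tsum_nonneg fun s => div_nonneg (norm_nonneg _) (hw0 s)
  -- `D + 1` rather than `D`, since `D` may be zero.
  have hη : 0 < δ / (D + 1) := by positivity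
  obtain ⟨T, hT, hTK⟩ := hP _ hK.isCompact_insert_range_of_cofinite _ hη
  refine ⟨T, hT, ?_⟩
  have hbound : ∀ s, ‖a s • T s - a s • (s : P)‖ ≤ δ / (D + 1) * (‖a s‖ / w s) := by
    intro s
    rcases eq_or_ne (a s) 0 with h0 | h0
    · simp [h0]
    have hws : 0 < w s := hw s (norm_ne_zero_iff.2 h0)
    have h1 := hTK _ (mem_insert_of_mem _ (mem_range_self s))
    rw [map_smul, ← smul_sub, norm_smul, Complex.norm_real, Real.norm_of_nonneg hws.le] at h1
    rw [← smul_sub]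
    calc ‖a s • (T s - s)‖ ≤ ‖a s‖ * ‖T s - s‖ := norm_smul_le _ _
      _ ≤ ‖a s‖ * (δ / (D + 1) / w s) := by
          gcongr
          rw [le_div_iff₀ hws, mul_comm]
          exact h1.le
      _ = _ := by ring
  have hle : ‖BallL1.lift T a - BallL1.lift (ContinuousLinearMap.id ℂ P) a‖ ≤
      δ / (D + 1) * D := by
    rw [← ((BallL1.hasSum_lift T a).sub (BallL1.hasSum_lift _ a)).tsum_eq]
    exact tsum_of_norm_bounded (hsum.hasSum.mul_left _) hbound
  refine hle.trans_lt ?_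
  rw [div_mul_eq_mul_div, div_lt_iff₀ (by positivity)]
  nlinarith

/-- A basis `e` of the range of `T` expands `lift T a` as a finite sum of slices `lift (g i) a ∈ I`
times `e i`. -/
theorem BallL1.lift_mem_of_finiteDimensional {I : Ideal A} {a : BallL1 A P}
    (ha : ∀ u : P →L[ℂ] A, lift u a ∈ I) (T : P →L[ℂ] P)
    [FiniteDimensional ℂ (LinearMap.range (T : P →ₗ[ℂ] P))] :
    lift T a ∈ I • (⊤ : Submodule A P) := by
  let V := LinearMap.range (T : P →ₗ[ℂ] P)
  let e := Module.finBasis ℂ V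
  let T' : P →L[ℂ] V := T.codRestrict V fun x => LinearMap.mem_range_self (T : P →ₗ[ℂ] P) x
  -- The coordinate functionals of `T`, viewed as operators into `ℂ • 1 ⊆ A` so that `lift` applies
  -- to them.
  let g (i) : P →L[ℂ] A := (ContinuousLinearMap.toSpanSingleton ℂ (1 : A)).comp
    ((LinearMap.toContinuousLinearMap (e.coord i)).comp T')
  have hT : ∀ x, T x = ∑ i, g i x • (e i : P) := fun x => by
    have h := congrArg (Subtype.val) (e.sum_repr (T' x))
    rw [AddSubmonoidClass.coe_finsetSum] at h
    simp only [g]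
    simpa [T'] using h.symm
  have hsum : lift T a = ∑ i, lift (g i) a • (e i : P) := by
    refine (hasSum_lift T a).unique ?_
    have := hasSum_sum (s := Finset.univ) fun i _ =>
      ((ContinuousLinearMap.toSpanSingleton A (e i : P)).hasSum (hasSum_lift (g i) a))
    simpa [hT, Finset.smul_sum, mul_smul] using this
  rw [hsum]
  exact Submodule.sum_mem _ fun i _ => Submodule.smul_mem_smul (ha _) Submodule.mem_top

theorem tradOuter_subset_closure_jacobson_smul (hproj : IsProjective A P)
    (happrox : HasApproximationProperty P) :
    tradOuter A P ⊆ closure ((Ring.jacobson A • (⊤ : Submodule A P) : Submodule A P) : Set P) := by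
  intro x hx
  obtain ⟨ρ, hρ, hf⟩ := hproj.exists_lift
  refine Metric.mem_closure_iff.2 fun δ hδ => ?_
  obtain ⟨T, hT, hlt⟩ := happrox.exists_norm_lift_sub_lt (ρ x) hδ
  refine ⟨BallL1.lift T (ρ x), BallL1.lift_mem_of_finiteDimensional (fun u => ?_) T, ?_⟩
  · obtain ⟨f, hf⟩ := hf u
    rw [hf]
    exact apply_mem_jacobson_of_mem_tradOuter hx f
  · rwa [hρ, ← dist_eq_norm, dist_comm] at hlt

end FreeModule

end BanachModule

theorem mainTheorem8 {A : Type u} [NormedRing A] [NormedAlgebra ℂ A] [CompleteSpace A]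
    {P : Type v} [NormedAddCommGroup P] [NormedSpace ℂ P] [CompleteSpace P]
    [Module A P] [IsScalarTower ℂ A P] [IsBoundedSMul A P]
    (hproj : BanachModule.IsProjective A P)
    (happrox : BanachModule.HasApproximationProperty P) :
    BanachModule.tradInner A P =
        closure ((Ring.jacobson A • (⊤ : Submodule A P) : Submodule A P) : Set P) ∧
      BanachModule.tradOuter A P =
        closure ((Ring.jacobson A • (⊤ : Submodule A P) : Submodule A P) : Set P) := by
  have h1 := BanachModule.closure_jacobson_smul_subset_tradInner (A := A) (X := P)
  have h2 := BanachModule.tradInner_subset_tradOuter (A := A) (X := P)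
  have h3 := BanachModule.tradOuter_subset_closure_jacobson_smul hproj happrox
  exact ⟨(h2.trans h3).antisymm h1, h3.antisymm (h1.trans h2)⟩
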